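/- Let $\mathcal X,\mathcal S,\mathcal A$ be finite sets with $\mathcal A\neq\emptyset$. An incidence structure on $(\mathcal X,\mathcal S)$ is a relation between the points $x\in\mathcal X$ and the block indices $s\in\mathcal S$; the block of $s$ is the set of points incident with $s$; the dual structure exchanges the roles of $\mathcal X$ and $\mathcal S$. A mosaic is a family $(D_\alpha)_{\alpha\in\mathcal A}$ of incidence structures on $(\mathcal X,\mathcal S)$, each with at least one incident pair, such that every pair $(x,s)$ is incident in exactly one $D_\alpha$. Its color rate is $\varrho=\log|\mathcal A|/\log|\mathcal X|$ and its block rate is $\log|\mathcal S|/\log|\mathcal X|$, where $\log=\log_2$. A $(u,m,k,\lambda_1,\lambda_2)$ group divisible design (GDD) is an incidence structure with a partition of $\mathcal X$ into $m$ point classes of size $u$ such that every block has exactly $k$ points, and two distinct points have exactly $\lambda_1\ge 0$ common block indices if they lie in the same class and exactly $\lambda_2\geq1$ otherwise. A $(u,k,\lambda)$ transversal design (TD) is a $(u,k,k,0,\lambda)$ GDD in which every block meets every point class in exactly one point. A mosaic of GDDs with constant block size is called block rate optimal if its block rate equals $2\varrho$. A $(v,k,\lambda)$ BIBD is an incidence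 structure with $v$ points such that every block has exactly $k$ points and any two distinct points have exactly $\lambda\ge1$ common block indices. An affine plane is a BIBD with block size at least $2$ whose block index set can be partitioned into parallel classes such that every point is incident with exactly one block index of each class, and such that any two blocks from different classes have exactly one point in common. Let $u\geq2$, and let $(D_\alpha)_{\alpha\in\mathcal A}$ be a block rate optimal mosaic of $(u,k,1)$ TDs. Then $$\varrho\;\geq\;\frac{\log u}{\log u+\log(u+1)},$$ and equality holds if and only if every $D_\alpha$ is the dual of an affine plane. -/

import Mathlib

/-- An incidence structure with point set `X` and block index set `S`. -/
@[ext]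
structure IncidenceStructure (X S : Type*) where
  /-- The incidence relation. -/
  Inc : X → S → Prop

namespace IncidenceStructure

variable {X S : Type*}

/-- The incidence structure is nonempty: some point is incident with some block index. -/
def IsNonempty (D : IncidenceStructure X S) : Prop :=
  ∃ x s, D.Inc x s

/-- The dual incidence structure, with points and block indices exchanged. -/
def dual (D : IncidenceStructure X S) : IncidenceStructure S X where
  Inc s x := D.Inc x s

/-- The set of points incident with the block index `s`. -/
def block (D : IncidenceStructure X S) (s : S) : Set X :=
  {x | D.Inc x s}

/-- The set of block indices that are incident with both `x` and `y`. -/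
def commonBlocks (D : IncidenceStructure X S) (x y : X) : Set S :=
  {s | D.Inc x s ∧ D.Inc y s}

/-- `(v, k, l)` balanced incomplete block designs: there are `v` points, every block index is
incident with exactly `k` points, and two distinct points have exactly `l ≥ 1` common block
indices. -/
structure IsBIBD (D : IncidenceStructure X S) (v k l : ℕ) : Prop where
  card_points : Nat.card X = v
  block_card : ∀ s, (D.block s).ncard = k
  one_le : 1 ≤ l
  common_card : ∀ x y, x ≠ y → (D.commonBlocks x y).ncard = l

/-- `R` is a partition of the block index set into parallel classes: every point is incident with
a unique block index of every class. -/
structure IsResolution (D : IncidenceStructure X S) (R : Set (Set S)) : Prop where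
  isPartition : Setoid.IsPartition R
  existsUnique : ∀ P ∈ R, ∀ x, ∃! s, s ∈ P ∧ D.Inc x s

/-- `D` has a resolution for which any two non-parallel blocks (blocks from different parallel
classes) have exactly `μ > 0` points in common. -/
def IsAffineResolvable (D : IncidenceStructure X S) (μ : ℕ) : Prop :=
  0 < μ ∧ ∃ R : Set (Set S), D.IsResolution R ∧
    ∀ P ∈ R, ∀ Q ∈ R, P ≠ Q → ∀ s ∈ P, ∀ t ∈ Q, (D.block s ∩ D.block t).ncard = μ

/-- An affine plane: an affine BIBD in which non-parallel blocks have exactly one point in common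
and whose block size is at least 2. -/
def IsAffinePlane (D : IncidenceStructure X S) : Prop :=
  ∃ v k l : ℕ, D.IsBIBD v k l ∧ 2 ≤ k ∧ D.IsAffineResolvable 1

/-- `(u, m, k, l₁, l₂)` group divisible designs with the set `G` of point classes. -/
structure IsGDDWith (D : IncidenceStructure X S) (G : Set (Set X)) (u m k l₁ l₂ : ℕ) : Prop where
  isPartition : Setoid.IsPartition G
  card_classes : G.ncard = m
  class_card : ∀ C ∈ G, C.ncard = u
  block_card : ∀ s, (D.block s).ncard = k
  one_le : 1 ≤ l₂
  common_card_of_same : ∀ C ∈ G, ∀ x ∈ C, ∀ y ∈ C, x ≠ y →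
    (D.commonBlocks x y).ncard = l₁
  common_card_of_ne : ∀ C ∈ G, ∀ C' ∈ G, C ≠ C' → ∀ x ∈ C, ∀ y ∈ C',
    (D.commonBlocks x y).ncard = l₂

/-- `(u, m, k, l₁, l₂)` group divisible designs. -/
def IsGDD (D : IncidenceStructure X S) (u m k l₁ l₂ : ℕ) : Prop :=
  ∃ G : Set (Set X), D.IsGDDWith G u m k l₁ l₂

/-- `(u, k, l)` transversal designs: `(u, k, k, 0, l)` group divisible designs in which every
block meets every point class in exactly one point. -/
def IsTransversalDesign (D : IncidenceStructure X S) (u k l : ℕ) : Prop :=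
  ∃ G : Set (Set X), D.IsGDDWith G u k k 0 l ∧ ∀ s, ∀ C ∈ G, ∃! x, x ∈ C ∧ D.Inc x s

/-- A mosaic on `(X, S)` with color set `A`: a family of nonempty incidence structures such that
every pair `(x, s)` is incident in exactly one of them. -/
structure IsMosaic {A : Type*} (D : A → IncidenceStructure X S) : Prop where
  isNonempty : ∀ α, (D α).IsNonempty
  existsUnique : ∀ x s, ∃! α, (D α).Inc x s

/-- The color rate `log |A| / log |X|` of a mosaic with color set `A`. -/
noncomputable def colorRate {A : Type*} (_D : A → IncidenceStructure X S) : ℝ :=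
  Real.logb 2 (Nat.card A) / Real.logb 2 (Nat.card X)

/-- The block rate `log |S| / log |X|` of a mosaic. -/
noncomputable def blockRate {A : Type*} (_D : A → IncidenceStructure X S) : ℝ :=
  Real.logb 2 (Nat.card S) / Real.logb 2 (Nat.card X)

/-- Block rate optimality: a mosaic of group divisible designs of constant block size whose block
rate equals twice its color rate, the smallest value that is possible for such mosaics. -/
structure IsBlockRateOptimal {A : Type*} (D : A → IncidenceStructure X S) : Prop where
  isMosaic : IsMosaic D
  isGDD : ∃ k : ℕ, ∀ α, ∃ u m l₁ l₂ : ℕ, (D α).IsGDD u m k l₁ l₂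
  blockRate_eq : blockRate D = 2 * colorRate D

end IncidenceStructure

/-! For a fixed block index, its blocks in the `D α` partition the points, so `|X| = |A| k`. A
transversal design has `|X| = k u`, hence `|A| = u` and the color rate is `log u / (log u + log k)`.
The claim thus reduces to `k ≤ u + 1`, with equality exactly for duals of affine planes.

Fix a block `s`. Each of its `k` points lies on `u - 1` of the `u² - 1` other blocks, and each of
those meets `s` at most once, so `k (u - 1) ≤ u² - 1`. Equality means that any two blocks meet
exactly once, so the dual is a BIBD; the point classes are then its parallel classes. -/

/-- Double counting, as an inequality: if every element of `s` is related to at least `m` elements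
of `t`, and every element of `t` to at most `n` elements of `s`, then `|s| m ≤ |t| n`. -/
theorem Set.ncard_mul_le_ncard_mul {X Y : Type*} [Finite X] [Finite Y] (r : X → Y → Prop)
    (s : Set X) (t : Set Y) (m n : ℕ)
    (hm : ∀ x ∈ s, m ≤ {y | y ∈ t ∧ r x y}.ncard)
    (hn : ∀ y ∈ t, {x | x ∈ s ∧ r x y}.ncard ≤ n) :
    s.ncard * m ≤ t.ncard * n := by
  classical
  have := Fintype.ofFinite X
  have := Fintype.ofFinite Y
  rw [Set.ncard_eq_toFinset_card', Set.ncard_eq_toFinset_card']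
  refine Finset.card_mul_le_card_mul r (fun x hx => ?_) (fun y hy => ?_)
  · refine (hm x (by simpa using hx)).trans (le_of_eq ?_)
    rw [← Set.ncard_coe_finset]
    congr 1
    ext y
    simp [Finset.bipartiteAbove]
  · refine le_trans (le_of_eq ?_) (hn y (by simpa using hy))
    rw [← Set.ncard_coe_finset]
    congr 1
    ext x
    simp [Finset.bipartiteBelow]

/-- Double counting: if every element of `s` is related to exactly `m` elements of `t`, and every
element of `t` to exactly `n` elements of `s`, then `|s| m = |t| n`. -/
theorem Set.ncard_mul_eq_ncard_mul {X Y : Type*} [Finite X] [Finite Y] (r : X → Y → Prop)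
    (s : Set X) (t : Set Y) (m n : ℕ)
    (hm : ∀ x ∈ s, {y | y ∈ t ∧ r x y}.ncard = m)
    (hn : ∀ y ∈ t, {x | x ∈ s ∧ r x y}.ncard = n) :
    s.ncard * m = t.ncard * n :=
  le_antisymm
    (Set.ncard_mul_le_ncard_mul r s t m n (fun x hx => (hm x hx).ge) fun y hy => (hn y hy).le)
    (Set.ncard_mul_le_ncard_mul (fun y x => r x y) t s n m (fun y hy => (hn y hy).ge)
      fun x hx => (hm x hx).le)

theorem Set.ncard_setOf_eq_one_of_existsUnique {X : Type*} {p : X → Prop} (h : ∃! x, p x) :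
    {x | p x}.ncard = 1 := by
  obtain ⟨a, ha, hu⟩ := h
  exact Set.ncard_eq_one.2 ⟨a, Set.ext fun x => ⟨fun hx => hu x hx, fun hx => by
    rw [Set.mem_singleton_iff.1 hx]; exact ha⟩⟩

namespace IncidenceStructure

variable {X S : Type*} [Finite X] {D : IncidenceStructure X S} {G : Set (Set X)}
  {u m k l₁ l₂ : ℕ}

theorem IsGDDWith.card_eq (h : D.IsGDDWith G u m k l₁ l₂) : Nat.card X = m * u := by
  have := Set.ncard_mul_eq_ncard_mul (fun (x : X) (C : Set X) => x ∈ C) Set.univ G 1 u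
    (fun x _ => Set.ncard_setOf_eq_one_of_existsUnique (h.isPartition.2 x))
    (fun C hC => by simpa using h.class_card C hC)
  rwa [mul_one, Set.ncard_univ, h.card_classes] at this

/-- In a mosaic of incidence structures of constant block size `k`, there are `|A| k` points. -/
theorem IsMosaic.card_points {A : Type*} [Finite A] {D : A → IncidenceStructure X S}
    (hM : IsMosaic D) (s : S) (hk : ∀ α, ((D α).block s).ncard = k) :
    Nat.card X = Nat.card A * k := by
  have := Set.ncard_mul_eq_ncard_mul (fun (x : X) (α : A) => (D α).Inc x s) Set.univ Set.univ 1 k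
    (fun x _ => by simpa using Set.ncard_setOf_eq_one_of_existsUnique (hM.existsUnique x s))
    (fun α _ => by simpa [block] using hk α)
  rwa [mul_one, Set.ncard_univ, Set.ncard_univ] at this

variable [Finite S]

/-- Every point of a transversal design of index one with at least two point classes is incident
with exactly `u` block indices. -/
theorem IsGDDWith.ncard_blocks_through (h : D.IsGDDWith G u k k 0 1)
    (hG : ∀ s, ∀ C ∈ G, ∃! x, x ∈ C ∧ D.Inc x s) (hk : 2 ≤ k) (x : X) :
    {s | D.Inc x s}.ncard = u := by
  obtain ⟨C, ⟨hC, hxC⟩, -⟩ := h.isPartition.2 x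
  obtain ⟨C', hC', hne⟩ := Set.exists_ne_of_one_lt_ncard (h.card_classes.symm ▸ hk : 1 < G.ncard) C
  -- The blocks through `x` biject with the points of a class `C'` not containing `x`: each meets
  -- `C'` once, and each point of `C'` is joined to `x` by one block.
  have := Set.ncard_mul_eq_ncard_mul (fun (s : S) (y : X) => D.Inc y s) {s | D.Inc x s} C' 1 1
    (fun s _ => Set.ncard_setOf_eq_one_of_existsUnique (hG s C' hC'))
    (fun y hy => h.common_card_of_ne C hC C' hC' hne.symm x hxC y hy)
  rwa [mul_one, mul_one, h.class_card C' hC'] at this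

/-- A transversal design of index one with at least two point classes has `u ^ 2` block
indices. -/
theorem IsGDDWith.card_blocks (h : D.IsGDDWith G u k k 0 1)
    (hG : ∀ s, ∀ C ∈ G, ∃! x, x ∈ C ∧ D.Inc x s) (hk : 2 ≤ k) :
    Nat.card S = u * u := by
  obtain ⟨C, hC⟩ : G.Nonempty := Set.nonempty_of_ncard_ne_zero (by rw [h.card_classes]; omega)
  have := Set.ncard_mul_eq_ncard_mul (fun (s : S) (y : X) => D.Inc y s) Set.univ C 1 u
    (fun s _ => Set.ncard_setOf_eq_one_of_existsUnique (hG s C hC))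
    (fun y _ => by simpa using h.ncard_blocks_through hG hk y)
  rwa [mul_one, Set.ncard_univ, h.class_card C hC] at this

/-- Two different block indices of a transversal design of index one have at most one common
point. -/
theorem IsGDDWith.ncard_inter_le_one (h : D.IsGDDWith G u k k 0 1)
    (hG : ∀ s, ∀ C ∈ G, ∃! x, x ∈ C ∧ D.Inc x s) {s t : S} (hst : s ≠ t) :
    {x | D.Inc x s ∧ D.Inc x t}.ncard ≤ 1 := by
  refine (Set.ncard_le_one).2 ?_
  rintro x ⟨hxs, hxt⟩ y ⟨hys, hyt⟩
  by_contra hxy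
  obtain ⟨C, ⟨hC, hxC⟩, -⟩ := h.isPartition.2 x
  obtain ⟨C', ⟨hC', hyC'⟩, -⟩ := h.isPartition.2 y
  by_cases hCC : C = C'
  · subst hCC
    exact hxy ((hG s C hC).unique ⟨hxC, hxs⟩ ⟨hyC', hys⟩)
  · have h1 := h.common_card_of_ne C hC C' hC' hCC x hxC y hyC'
    exact hst ((Set.ncard_le_one).1 h1.le s ⟨hxs, hys⟩ t ⟨hxt, hyt⟩)

/-- Supplies the degree of a point in the counts of incidences between a fixed block and the
remaining blocks. -/
theorem IsGDDWith.ncard_other_blocks_through (h : D.IsGDDWith G u k k 0 1)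
    (hG : ∀ s, ∀ C ∈ G, ∃! x, x ∈ C ∧ D.Inc x s) (hk : 2 ≤ k) {s : S} {x : X}
    (hxs : D.Inc x s) :
    {t | t ∈ ({s}ᶜ : Set S) ∧ D.Inc x t}.ncard = u - 1 := by
  rw [← h.ncard_blocks_through hG hk x,
    ← Set.ncard_sdiff_singleton_of_mem (show s ∈ {t | D.Inc x t} from hxs)]
  congr 1
  ext t
  simp [and_comm]

/-- The number of point classes of a transversal design of index one is at most `u + 1`. -/
theorem IsGDDWith.le_add_one (h : D.IsGDDWith G u k k 0 1)
    (hG : ∀ s, ∀ C ∈ G, ∃! x, x ∈ C ∧ D.Inc x s) (hu : 2 ≤ u) : k ≤ u + 1 := by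
  -- The block counts need a second point class; for `k ≤ 1` the bound is trivial.
  by_cases hk : 2 ≤ k
  swap
  · omega
  have hS := h.card_blocks hG hk
  have : Nonempty S := (Nat.card_pos_iff.1 (by rw [hS]; positivity)).1
  obtain ⟨s⟩ := this
  have hle := Set.ncard_mul_le_ncard_mul D.Inc (D.block s) {s}ᶜ (u - 1) 1
    (fun x hx => (h.ncard_other_blocks_through hG hk hx).ge)
    (fun t ht => h.ncard_inter_le_one hG (Ne.symm ht))
  rw [h.block_card, Set.ncard_compl, Set.ncard_singleton, hS] at hle
  obtain ⟨w, rfl⟩ : ∃ w, u = w + 1 := ⟨u - 1, by omega⟩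
  have h2 : (w + 1) * (w + 1) - 1 = (w + 2) * w := by
    rw [show (w + 1) * (w + 1) = (w + 2) * w + 1 by ring]; simp
  rw [Nat.add_sub_cancel, mul_one, h2] at hle
  exact Nat.le_of_mul_le_mul_right hle (by omega)

/-- In a transversal design of index one with `u + 1` point classes, any two different block
indices have exactly one common point. -/
theorem IsGDDWith.ncard_inter_eq_one (h : D.IsGDDWith G u (u + 1) (u + 1) 0 1)
    (hG : ∀ s, ∀ C ∈ G, ∃! x, x ∈ C ∧ D.Inc x s) (hu : 2 ≤ u) {s t : S} (hst : s ≠ t) :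
    {x | D.Inc x s ∧ D.Inc x t}.ncard = 1 := by
  refine le_antisymm (h.ncard_inter_le_one hG hst) ?_
  by_contra hlt
  have hdis : ∀ x, D.Inc x s → ¬ D.Inc x t := by
    intro x hs ht
    have h0 : {x | D.Inc x s ∧ D.Inc x t} = ∅ :=
      (Set.ncard_eq_zero).1 (by omega)
    exact (h0 ▸ (⟨hs, ht⟩ : x ∈ {x | D.Inc x s ∧ D.Inc x t}) : x ∈ (∅ : Set X))
  -- If `s` and `t` were disjoint, the `(u + 1)(u - 1) = u² - 1` incidences would have to fit on `u²
  -- - 2` blocks.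
  have hle := Set.ncard_mul_le_ncard_mul D.Inc (D.block s) ({s}ᶜ \ {t}) (u - 1) 1
    (fun x hx => by
      rw [← h.ncard_other_blocks_through hG (by omega) hx]
      refine Set.ncard_le_ncard fun b hb => ⟨⟨hb.1, ?_⟩, hb.2⟩
      rintro rfl
      exact hdis x hx hb.2)
    (fun b hb => h.ncard_inter_le_one hG (Ne.symm hb.1))
  rw [h.block_card, Set.ncard_sdiff_singleton_of_mem (by simpa using hst.symm), Set.ncard_compl,
    Set.ncard_singleton, h.card_blocks hG (by omega)] at hle
  obtain ⟨w, rfl⟩ : ∃ w, u = w + 2 := ⟨u - 2, by omega⟩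
  have h2 : (w + 2) * (w + 2) = (w + 2 + 1) * (w + 1) + 1 := by ring
  have h3 : 0 < (w + 2 + 1) * (w + 1) := by positivity
  have h4 : w + 2 - 1 = w + 1 := by omega
  rw [h4, h2] at hle
  omega

/-- The dual of a transversal design of index one with `u + 1` point classes is an affine
plane. -/
theorem IsGDDWith.isAffinePlane_dual (h : D.IsGDDWith G u (u + 1) (u + 1) 0 1)
    (hG : ∀ s, ∀ C ∈ G, ∃! x, x ∈ C ∧ D.Inc x s) (hu : 2 ≤ u) : D.dual.IsAffinePlane :=
  ⟨u * u, u, 1,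
    { card_points := h.card_blocks hG (by omega)
      block_card := fun x => h.ncard_blocks_through hG (by omega) x
      one_le := le_rfl
      common_card := fun _ _ hst => h.ncard_inter_eq_one hG hu hst },
    -- Transversality makes `G` a resolution of the dual; index one makes non-parallel dual blocks
    -- meet once.
    hu, one_pos, G, ⟨h.isPartition, fun C hC s => hG s C hC⟩,
    fun C hC C' hC' hne x hx y hy => h.common_card_of_ne C hC C' hC' hne x hx y hy⟩

/-- A transversal design of index one that is the dual of an affine plane has `u + 1` point
classes. -/
theorem IsGDDWith.eq_add_one_of_isAffinePlane_dual (h : D.IsGDDWith G u k k 0 1)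
    (hG : ∀ s, ∀ C ∈ G, ∃! x, x ∈ C ∧ D.Inc x s) (hu : 2 ≤ u) (hk : 0 < k)
    (hD : D.dual.IsAffinePlane) : k = u + 1 := by
  obtain ⟨v, r, l, hB, hr, -⟩ := hD
  have hinter : ∀ s t, s ≠ t → 1 ≤ {x | D.Inc x s ∧ D.Inc x t}.ncard := fun s t hst =>
    hB.one_le.trans (hB.common_card s t hst).ge
  have hthrough : ∀ x, ∃ s, D.Inc x s := fun x =>
    Set.nonempty_of_ncard_ne_zero (s := D.dual.block x) (by rw [hB.block_card x]; omega)
  -- With a single point class, blocks through distinct points would be disjoint, but any two blocks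
  -- meet.
  have hk2 : 2 ≤ k := by
    by_contra hlt
    obtain rfl : k = 1 := by omega
    obtain ⟨C, hC⟩ := Set.ncard_eq_one.1 h.card_classes
    have hCG : C ∈ G := by simp [hC]
    obtain ⟨x, hx, y, hy, hxy⟩ := (Set.one_lt_ncard).1
      (by rw [h.class_card C hCG]; omega : 1 < C.ncard)
    obtain ⟨s, hs⟩ := hthrough x
    obtain ⟨t, ht⟩ := hthrough y
    have hne : s ≠ t := by
      rintro rfl
      exact hxy ((hG s C hCG).unique ⟨hx, hs⟩ ⟨hy, ht⟩)
    obtain ⟨z, hzs, hzt⟩ := Set.nonempty_of_ncard_ne_zero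
      (Nat.one_le_iff_ne_zero.1 (hinter s t hne))
    have hxz := (Set.ncard_le_one).1 (h.block_card s).le x hs z hzs
    have hyz := (Set.ncard_le_one).1 (h.block_card t).le y ht z hzt
    exact hxy (hxz.trans hyz.symm)
  refine le_antisymm (h.le_add_one hG hu) ?_
  have hS := h.card_blocks hG hk2
  obtain ⟨s⟩ : Nonempty S := (Nat.card_pos_iff.1 (by rw [hS]; positivity)).1
  -- The same count reversed: every other block meets `s`, so `u² - 1 ≤ k (u - 1)`.
  have hle := Set.ncard_mul_le_ncard_mul (fun t x => D.Inc x t) {s}ᶜ (D.block s) 1 (u - 1)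
    (fun t ht => hinter s t (Ne.symm ht))
    (fun x hx => (h.ncard_other_blocks_through hG hk2 hx).le)
  rw [h.block_card, Set.ncard_compl, Set.ncard_singleton, hS] at hle
  obtain ⟨w, rfl⟩ : ∃ w, u = w + 1 := ⟨u - 1, by omega⟩
  have h2 : (w + 1) * (w + 1) - 1 = (w + 2) * w := by
    rw [show (w + 1) * (w + 1) = (w + 2) * w + 1 by ring]; simp
  rw [Nat.add_sub_cancel, mul_one, h2] at hle
  exact Nat.le_of_mul_le_mul_right hle (by omega)

end IncidenceStructure

theorem mainTheorem8 {X S A : Type*} [Finite X] [Finite S] [Finite A] [Nonempty A]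
    (u k : ℕ) (hu : 2 ≤ u) (D : A → IncidenceStructure X S)
    (hM : IncidenceStructure.IsMosaic D)
    (hTD : ∀ α, (D α).IsTransversalDesign u k 1)
    (hopt : IncidenceStructure.IsBlockRateOptimal D) :
    IncidenceStructure.colorRate D ≥
        Real.logb 2 u / (Real.logb 2 u + Real.logb 2 ((u : ℝ) + 1)) ∧
      (IncidenceStructure.colorRate D =
          Real.logb 2 u / (Real.logb 2 u + Real.logb 2 ((u : ℝ) + 1)) ↔
        ∀ α, ∃ P : IncidenceStructure S X, P.IsAffinePlane ∧ D α = P.dual) := by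
  choose G hGDD hG using hTD
  obtain ⟨α₀⟩ := ‹Nonempty A›
  obtain ⟨x₀, s₀, -⟩ := hM.isNonempty α₀
  have hX : Nat.card X = k * u := (hGDD α₀).card_eq
  have hXpos : 0 < Nat.card X := Nat.card_pos_iff.2 ⟨⟨x₀⟩, inferInstance⟩
  have hk : 0 < k := Nat.pos_of_mul_pos_right (hX ▸ hXpos)
  have hA : Nat.card A = u := by
    have h := hM.card_points s₀ fun α => (hGDD α).block_card s₀
    rw [hX, mul_comm] at h
    exact (Nat.eq_of_mul_eq_mul_right hk h).symm
  have hku : k ≤ u + 1 := (hGDD α₀).le_add_one (hG α₀) hu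
  have hkR : (0 : ℝ) < k := by exact_mod_cast hk
  have huR : (1 : ℝ) < u := by exact_mod_cast hu
  have hlu : 0 < Real.logb 2 u := Real.logb_pos one_lt_two huR
  have hlk : 0 ≤ Real.logb 2 k := Real.logb_nonneg one_lt_two (by exact_mod_cast hk)
  have hrate : IncidenceStructure.colorRate D =
      Real.logb 2 u / (Real.logb 2 u + Real.logb 2 k) := by
    rw [IncidenceStructure.colorRate, hA, hX, Nat.cast_mul, mul_comm,
      Real.logb_mul (by positivity) hkR.ne']
  have hlog : Real.logb 2 k ≤ Real.logb 2 ((u : ℝ) + 1) :=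
    Real.logb_le_logb_of_le one_lt_two hkR (by exact_mod_cast hku)
  rw [hrate]
  refine ⟨div_le_div_of_nonneg_left hlu.le (by positivity) (by linarith), ?_, ?_⟩
  · intro heq α
    have h1 : Real.logb 2 u + Real.logb 2 k = Real.logb 2 u + Real.logb 2 ((u : ℝ) + 1) := by
      rw [div_eq_div_iff (by positivity) (by linarith)] at heq
      exact (mul_left_cancel₀ hlu.ne' heq).symm
    have h2 : (k : ℝ) = (u : ℝ) + 1 :=
      Real.logb_injOn_pos one_lt_two (Set.mem_Ioi.2 hkR) (Set.mem_Ioi.2 (by positivity))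
        (add_left_cancel h1)
    obtain rfl : k = u + 1 := by exact_mod_cast h2
    exact ⟨(D α).dual, (hGDD α).isAffinePlane_dual (hG α) hu, rfl⟩
  · intro hP
    -- One color suffices, since `k` is common to all.
    obtain ⟨P, hP, hDP⟩ := hP α₀
    have hdual : (D α₀).dual = P := by rw [hDP]; rfl
    rw [(hGDD α₀).eq_add_one_of_isAffinePlane_dual (hG α₀) hu hk (hdual ▸ hP), Nat.cast_succ]
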